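/- **Theorem 3.5.** Let $X$ be a real Banach space that is uniformly convex and smooth. Here $X$ is *uniformly convex* if for every $\varepsilon>0$ there is $\delta>0$ such that $\|x+y\|\le 2-\delta$ whenever $\|x\|=\|y\|=1$ and $\|x-y\|\ge\varepsilon$, and $X$ is *smooth* if for every $x\in X\setminus\{0\}$ there is exactly one continuous linear functional $x^*\in X^*$ with $\|x^*\|=1$ and $\langle x^*,x\rangle=\|x\|$. Let $K\subseteq X$ be a *Čebyšev set*, that is, a nonempty set such that for every $x\in X$ there is exactly one $v\in K$ with $\|x-v\|=\inf_{w\in K}\|x-w\|$. If $K$ is closed in the weak topology of $X$, then $K$ is convex. -/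

import Mathlib

/-- `K` is a Čebyšev set in the normed space `X`: it is nonempty, and every point `x` of `X` has
exactly one best approximation in `K`, i.e. there is exactly one `v ∈ K` whose distance `‖x - v‖`
to `x` equals `inf {‖x - w‖ ; w ∈ K}`. -/
def IsChebyshevSet {X : Type*} [NormedAddCommGroup X] (K : Set X) : Prop :=
  K.Nonempty ∧ ∀ x : X, ∃! v : X, v ∈ K ∧ ‖x - v‖ = Metric.infDist x K

/-- `f` is a support functional corresponding to `x`: a continuous linear functional of norm one
with `f x = ‖x‖`. -/
def IsSupportFunctional {X : Type*} [NormedAddCommGroup X] [NormedSpace ℝ X]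
    (f : StrongDual ℝ X) (x : X) : Prop :=
  ‖f‖ = 1 ∧ f x = ‖x‖

/-- The real normed space `X` is smooth: every nonzero `x` has exactly one support functional. -/
def IsSmoothNormedSpace (X : Type*) [NormedAddCommGroup X] [NormedSpace ℝ X] : Prop :=
  ∀ x : X, x ≠ 0 → ∃! f : StrongDual ℝ X, IsSupportFunctional f x

/-- `K` is closed in the weak topology of `X`. -/
def IsWeaklyClosed {X : Type*} [NormedAddCommGroup X] [NormedSpace ℝ X] (K : Set X) : Prop :=
  IsClosed (toWeakSpace ℝ X '' K)

open Filter Topology Set Metric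

/-! Weak compactness of balls and weak closedness give every minimizing ultrafilter in K the best
approximation as weak limit, and uniform convexity makes the convergence strong. So the metric
projection P is continuous, which lets the distance to K grow with slope almost one from any point
off K. Put r = d(x, K) > 0. Ekeland's principle on the ball of radius r about x follows this growth
to a boundary point at distance almost 2r from K; uniform convexity forces that point near 2x - P x,
so d(2x - P x, K) = 2r. Iterating, P x stays nearest to P x + 2^n (x - P x): K is a sun. Hence K
misses ever larger balls touching P x; smoothness turns this into a half-space containing K but not
x. -/

/-! ### Uniform convexity and weak compactness -/

/-- A version of uniform convexity for vectors that are almost in the ball of radius `c`. -/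
theorem exists_forall_norm_le_add_norm_sub_lt {E : Type*} [NormedAddCommGroup E] [NormedSpace ℝ E]
    [UniformConvexSpace E] {ε : ℝ} (hε : 0 < ε) {c : ℝ} (hc : 0 ≤ c) :
    ∃ δ, 0 < δ ∧ ∀ a b : E, ‖a‖ ≤ c + δ → ‖b‖ ≤ c + δ → 2 * c - δ ≤ ‖a + b‖ → ‖a - b‖ < ε := by
  obtain ⟨δ, hδ, h⟩ := exists_forall_closed_ball_dist_add_le_two_mul_sub E (half_pos hε) c
  -- Shrinking both vectors into the ball costs at most 2η in the sum and in the difference; the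
  -- last step needs 3η < δ.
  obtain ⟨η, hη, hηδ, hηε⟩ : ∃ η, 0 < η ∧ 4 * η ≤ δ ∧ 4 * η ≤ ε :=
    ⟨min (δ / 4) (ε / 4), by positivity, by linarith [min_le_left (δ / 4) (ε / 4)],
      by linarith [min_le_right (δ / 4) (ε / 4)]⟩
  have approx : ∀ a : E, ‖a‖ ≤ c + η → ∃ a' : E, ‖a'‖ ≤ c ∧ ‖a - a'‖ ≤ η := by
    intro a ha
    have hpos : 0 < c + η := by linarith
    refine ⟨(c / (c + η)) • a, ?_, ?_⟩
    · rw [norm_smul_of_nonneg (by positivity), div_mul_eq_mul_div, div_le_iff₀ hpos]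
      gcongr
    · have : a - (c / (c + η)) • a = (η / (c + η)) • a := by
        nth_rw 1 [← one_smul ℝ a]
        rw [← sub_smul]
        congr 1
        field_simp
        ring
      rw [this, norm_smul_of_nonneg (by positivity), div_mul_eq_mul_div, div_le_iff₀ hpos]
      gcongr
  refine ⟨η, hη, fun a b ha hb hab => ?_⟩
  obtain ⟨a', ha', haa'⟩ := approx a ha
  obtain ⟨b', hb', hbb'⟩ := approx b hb
  by_contra! hlt
  have h1 : ‖a + b‖ ≤ ‖a' + b'‖ + ‖a - a'‖ + ‖b - b'‖ := by
    have : a + b = a' + b' + (a - a') + (b - b') := by abel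
    rw [this]
    exact norm_add₃_le
  have h2 : ‖a - b‖ ≤ ‖a' - b'‖ + ‖a - a'‖ + ‖b - b'‖ := by
    have : a - b = a' - b' + (a - a') + (b' - b) := by abel
    rw [this, norm_sub_rev b b']
    exact norm_add₃_le
  have := h ha' hb' (by linarith)
  linarith

/-- In a uniformly convex Banach space, a bounded ultrafilter has a point that is common to all its
closed convex members. This is a form of weak compactness of closed balls. -/
theorem exists_forall_mem_ultrafilter_imp_mem {E : Type*} [NormedAddCommGroup E]
    [NormedSpace ℝ E] [CompleteSpace E] [UniformConvexSpace E] (U : Ultrafilter E) {R : ℝ}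
    (hR : closedBall (0 : E) R ∈ U) :
    ∃ w : E, ∀ C : Set E, Convex ℝ C → IsClosed C → C ∈ U → w ∈ C := by
  have hmono : Monotone (fun s : Set E => convexHull ℝ s) := fun _ _ h => convexHull_mono h
  set G : Filter E := (U : Filter E).lift' (fun s => convexHull ℝ s) with hG
  have hGne : G.NeBot := (lift'_neBot_iff hmono).2 fun s hs =>
    (convexHull_nonempty_iff).2 (U.nonempty_of_mem hs)
  have hmemG : ∀ C : Set E, Convex ℝ C → C ∈ U → C ∈ G := fun C hC hCU =>
    (mem_lift'_sets hmono).2 ⟨C, hCU, hC.convexHull_eq.subset⟩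
  have hbdd : G.IsBoundedUnder (· ≥ ·) (fun z : E => ‖z‖) := ⟨0, by simp⟩
  have hcobdd : G.IsCoboundedUnder (· ≥ ·) (fun z : E => ‖z‖) := by
    refine IsBoundedUnder.isCoboundedUnder_ge ⟨R, ?_⟩
    rw [eventually_map]
    filter_upwards [hmemG _ (convex_closedBall 0 R) hR] with z hz
    simpa using hz
  set c := liminf (fun z : E => ‖z‖) G with hc
  have hc0 : 0 ≤ c := le_liminf_of_le hcobdd (Eventually.of_forall fun z => norm_nonneg z)
  -- `F` selects almost norm-minimal points of the hulls. Midpoints stay in a hull, so their norms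
  -- are almost at least `c`, and uniform convexity makes `F` Cauchy.
  set F : Filter E := G ⊓ comap (fun z : E => ‖z‖) (⨅ ε : Ioi (0 : ℝ), 𝓟 (Iio (c + ε))) with hF
  have hbasis : (⨅ ε : Ioi (0 : ℝ), 𝓟 (Iio (c + ε))).HasBasis (fun ε : ℝ => 0 < ε)
      (fun ε => Iio (c + ε)) := by
    rw [iInf_subtype (f := fun ε : Ioi (0 : ℝ) => 𝓟 (Iio (c + ε)))]
    refine hasBasis_biInf_principal (s := fun ε : ℝ => Iio (c + ε)) (S := Ioi 0) ?_
      ⟨1, mem_Ioi.2 one_pos⟩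
    intro a ha b hb
    exact ⟨min a b, mem_Ioi.2 (lt_min ha hb), Iio_subset_Iio (by simp), Iio_subset_Iio (by simp)⟩
  have hFmem : ∀ ε : ℝ, 0 < ε → ∀ᶠ z in F, ‖z‖ < c + ε := fun ε hε =>
    mem_inf_of_right (preimage_mem_comap (hbasis.mem_of_mem hε))
  have hFne : F.NeBot := by
    rw [hF, inf_comm, (hbasis.comap _).inf_basis_neBot_iff G.basis_sets]
    intro ε hε s hs
    obtain ⟨z, hz, hzs⟩ := ((frequently_lt_of_liminf_lt hcobdd
      (show c < c + ε by linarith)).and_eventually hs).exists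
    exact ⟨z, hz, hzs⟩
  have hcauchy : Cauchy F := by
    refine Metric.cauchy_iff.2 ⟨hFne, fun ε hε => ?_⟩
    obtain ⟨δ, hδ, h⟩ := exists_forall_norm_le_add_norm_sub_lt (E := E) hε hc0
    have hev : ∀ᶠ z in G, c - δ / 2 < ‖z‖ :=
      eventually_lt_of_lt_liminf (by linarith) hbdd
    obtain ⟨A, hA, hAs⟩ := (mem_lift'_sets hmono).1 hev
    refine ⟨convexHull ℝ A ∩ {z | ‖z‖ < c + δ}, inter_mem (mem_inf_of_left (mem_lift' hA))
      (hFmem δ hδ), ?_⟩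
    rintro a ⟨haA, ha⟩ b ⟨hbA, hb⟩
    rw [dist_eq_norm]
    refine h a b (le_of_lt ha) (le_of_lt hb) ?_
    have hm := hAs ((convex_convexHull ℝ A) haA hbA (a := 1 / 2) (b := 1 / 2) (by norm_num)
      (by norm_num) (by norm_num))
    rw [mem_ofPred_eq, ← smul_add, norm_smul_of_nonneg (by norm_num)] at hm
    linarith
  obtain ⟨w, hw⟩ := CompleteSpace.complete hcauchy
  exact ⟨w, fun C hC hCc hCU => hCc.mem_of_tendsto (f := id) (b := F) hw
    (mem_inf_of_left (hmemG C hC hCU))⟩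

/-! ### Continuity of the metric projection -/

/-- A weakly closed set contains the weak limits of its filters. -/
theorem IsWeaklyClosed.mem_of_tendsto {X : Type*} [NormedAddCommGroup X] [NormedSpace ℝ X]
    {K : Set X} (hK : IsWeaklyClosed K) {l : Filter X} [l.NeBot] (hl : K ∈ l) {w : X}
    (hw : ∀ f : StrongDual ℝ X, Tendsto f l (𝓝 (f w))) : w ∈ K := by
  have hinj : Function.Injective ((topDualPairing ℝ X).flip) := by
    intro a b hab
    by_contra hne
    obtain ⟨f, hf⟩ := SeparatingDual.exists_separating_of_ne (R := ℝ) hne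
    exact hf (DFunLike.congr_fun hab f)
  have hlim : Tendsto (toWeakSpace ℝ X) l (𝓝 (toWeakSpace ℝ X w)) :=
    (WeakBilin.tendsto_iff_forall_eval_tendsto _ hinj).2 hw
  obtain ⟨v, hv, hvw⟩ := IsClosed.mem_of_tendsto hK hlim
    (mem_of_superset hl fun z hz => mem_image_of_mem _ hz)
  rwa [← (toWeakSpace ℝ X).injective hvw]

/-- Minimizing filters of a weakly closed Čebyšev set converge to the best approximation. -/
theorem IsWeaklyClosed.tendsto_bestApproximation {X : Type*} [NormedAddCommGroup X]
    [NormedSpace ℝ X] [CompleteSpace X] [UniformConvexSpace X] {K : Set X}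
    (hKw : IsWeaklyClosed K) {x p : X} (huniq : ∀ v ∈ K, ‖x - v‖ = infDist x K → v = p)
    {ι : Type*} {l : Filter ι} {u : ι → X} (hu : ∀ᶠ i in l, u i ∈ K)
    (hd : Tendsto (fun i => ‖x - u i‖) l (𝓝 (infDist x K))) : Tendsto u l (𝓝 p) := by
  rw [tendsto_iff_ultrafilter]
  intro g hg
  set U : Ultrafilter X := g.map u
  have hUK : K ∈ U := hg hu
  have hUd : Tendsto (fun z => ‖x - z‖) U (𝓝 (infDist x K)) := by
    rw [show (U : Filter X) = map u g from rfl, tendsto_map'_iff]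
    exact hd.mono_left hg
  set d := infDist x K
  have hd0 : 0 ≤ d := infDist_nonneg
  have hUball : ∀ ε, 0 < ε → closedBall x (d + ε) ∈ U := by
    intro ε hε
    filter_upwards [hUd.eventually (gt_mem_nhds (show d < d + ε by linarith))] with z hz
    rw [mem_closedBall, dist_eq_norm, norm_sub_rev]
    exact hz.le
  obtain ⟨w, hw⟩ := exists_forall_mem_ultrafilter_imp_mem U (R := ‖x‖ + (d + 1)) <| by
    filter_upwards [hUball 1 one_pos] with z hz
    rw [mem_closedBall, dist_eq_norm] at hz
    rw [mem_closedBall, dist_zero_right]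
    have : ‖z‖ ≤ ‖x‖ + ‖z - x‖ := by simpa using norm_add_le x (z - x)
    linarith
  have hweak : ∀ f : StrongDual ℝ X, Tendsto f U (𝓝 (f w)) := by
    intro f
    refine tendsto_order.2 ⟨fun a ha => ?_, fun a ha => ?_⟩
    -- Otherwise a closed half-space missing `w` would belong to the ultrafilter.
    · refine (Ultrafilter.eventually_not (p := fun z => f z ≤ a)).2 (fun h => ?_) |>.mono
        fun z hz => not_le.1 hz
      exact ha.not_ge (hw {z | f z ≤ a} (convex_halfSpace_le f.toLinearMap.isLinear a)
        (isClosed_le f.continuous continuous_const) h)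
    · refine (Ultrafilter.eventually_not (p := fun z => a ≤ f z)).2 (fun h => ?_) |>.mono
        fun z hz => not_le.1 hz
      exact ha.not_ge (hw {z | a ≤ f z} (convex_halfSpace_ge f.toLinearMap.isLinear a)
        (isClosed_le continuous_const f.continuous) h)
  have hwK : w ∈ K := hKw.mem_of_tendsto hUK hweak
  have hwd : ‖x - w‖ = d := by
    refine le_antisymm (le_of_forall_pos_le_add fun ε hε => ?_) ?_
    · have := hw _ (convex_closedBall x (d + ε)) isClosed_closedBall (hUball ε hε)
      rwa [mem_closedBall, dist_eq_norm, norm_sub_rev] at this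
    · rw [← dist_eq_norm]
      exact infDist_le_dist_of_mem hwK
  obtain rfl := huniq w hwK hwd
  suffices h : Tendsto id (U : Filter X) (𝓝 w) from h
  rw [Metric.tendsto_nhds]
  intro ε hε
  obtain ⟨δ, hδ, h⟩ := exists_forall_norm_le_add_norm_sub_lt (E := X) hε hd0
  -- Weak convergence tested on a functional norming `x - w` keeps the norm of `(x - w) + (x - z)`
  -- near `2 * d`.
  obtain ⟨f, hf1, hfw⟩ := exists_dual_vector'' ℝ (x - w)
  have hfw' : f x - f w = d := by
    rw [← map_sub, hfw, hwd]
    rfl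
  filter_upwards [hUball δ hδ, (hweak f).eventually (gt_mem_nhds (show f w < f w + δ by linarith))]
    with z hz hfz
  rw [mem_closedBall, dist_eq_norm, norm_sub_rev] at hz
  have hsum : 2 * d - δ ≤ ‖(x - w) + (x - z)‖ := by
    have h1 : f ((x - w) + (x - z)) ≤ ‖(x - w) + (x - z)‖ :=
      (le_abs_self _).trans ((f.le_opNorm _).trans
        (mul_le_of_le_one_left (norm_nonneg _) hf1))
    simp only [map_add, map_sub] at h1
    linarith
  have := h (x - w) (x - z) (by linarith) hz hsum
  rwa [sub_sub_sub_cancel_left, ← dist_eq_norm] at this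

/-! ### Growth of the distance function -/

/-- Ekeland's variational principle, for a continuous function bounded above. -/
theorem exists_forall_add_mul_dist_le_imp_eq {α : Type*} [MetricSpace α] [CompleteSpace α]
    {g : α → ℝ} (hg : Continuous g) (hb : BddAbove (range g)) {c : ℝ} (hc : 0 < c) (x : α) :
    ∃ y, g x + c * dist x y ≤ g y ∧ ∀ z, g y + c * dist y z ≤ g z → z = y := by
  set S : α → Set α := fun y => {z | g y + c * dist y z ≤ g z} with hS
  have hself : ∀ y, y ∈ S y := fun y => by simp [hS]
  have htrans : ∀ {a b e}, b ∈ S a → e ∈ S b → e ∈ S a := by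
    intro a b e hab hbe
    simp only [hS, mem_ofPred_eq] at *
    nlinarith [dist_triangle a b e]
  -- The sets `S y` are the up-sets of an order. Choosing almost maximal values in them leaves no
  -- room for `g` to rise above the limit.
  have hnext : ∀ (n : ℕ) (y : α), ∃ z ∈ S y, ∀ e ∈ S y, g e < g z + 1 / ((n : ℝ) + 1) := by
    intro n y
    have hne : (g '' S y).Nonempty := ⟨_, mem_image_of_mem g (hself y)⟩
    have hbd : BddAbove (g '' S y) := hb.mono (image_subset_range _ _)
    obtain ⟨_, ⟨z, hz, rfl⟩, hlt⟩ := exists_lt_of_lt_csSup hne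
      (show sSup (g '' S y) - 1 / ((n : ℝ) + 1) < sSup (g '' S y) by
        have : 0 < 1 / ((n : ℝ) + 1) := by positivity
        linarith)
    exact ⟨z, hz, fun e he => by linarith [le_csSup hbd (mem_image_of_mem g he)]⟩
  choose next hnextS hnextg using hnext
  let y : ℕ → α := fun n => Nat.rec x (fun n y => next n y) n
  have hy : ∀ n, y (n + 1) = next n (y n) := fun n => rfl
  have hyS : ∀ m n, m ≤ n → y n ∈ S (y m) := by
    intro m n hmn
    induction n, hmn using Nat.le_induction with
    | base => exact hself _
    | succ n _ ih => exact htrans ih (hy n ▸ hnextS n (y n))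
  have hgmono : Monotone (g ∘ y) := fun m n hmn => by
    have h : g (y m) + c * dist (y m) (y n) ≤ g (y n) := hyS m n hmn
    have : 0 ≤ c * dist (y m) (y n) := by positivity
    simp only [Function.comp_apply]
    linarith
  have hgbdd : BddAbove (range (g ∘ y)) := hb.mono (range_comp_subset_range y g)
  have hgc : CauchySeq (g ∘ y) := (tendsto_atTop_ciSup hgmono hgbdd).cauchySeq
  have hyc : CauchySeq y := by
    rw [Metric.cauchySeq_iff'] at hgc ⊢
    intro ε hε
    obtain ⟨N, hN⟩ := hgc (c * ε) (by positivity)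
    refine ⟨N, fun n hn => ?_⟩
    have h1 : g (y N) + c * dist (y N) (y n) ≤ g (y n) := hyS N n hn
    have h2 := (le_abs_self _).trans_lt (hN n hn)
    simp only [Function.comp_apply] at h2
    rw [dist_comm]
    exact lt_of_mul_lt_mul_left (by linarith) hc.le
  obtain ⟨w, hw⟩ := cauchySeq_tendsto_of_complete hyc
  have hclosed : ∀ a, IsClosed (S a) := fun a => isClosed_le (by fun_prop) hg
  have hwS : ∀ n, w ∈ S (y n) := fun n => (hclosed _).mem_of_tendsto hw
    ((eventually_ge_atTop n).mono fun m hm => hyS n m hm)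
  refine ⟨w, hwS 0, fun z hz => ?_⟩
  have hlim : Tendsto (fun n : ℕ => g (y (n + 1)) + 1 / ((n : ℝ) + 1)) atTop (𝓝 (g w + 0)) :=
    ((hg.tendsto w).comp (hw.comp (tendsto_add_atTop_nat 1))).add
      tendsto_one_div_add_atTop_nhds_zero_nat
  have hle : g z ≤ g w + 0 := ge_of_tendsto' hlim fun n =>
    (hy n ▸ hnextg n (y n) z (htrans (hwS n) hz)).le
  have hz' : g w + c * dist w z ≤ g z := hz
  have : dist w z ≤ 0 := by
    by_contra! hpos
    nlinarith [mul_pos hc hpos]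
  exact (dist_le_zero.1 this).symm

/-- If the metric projection `P` onto `K` is continuous at a point `x` outside `K`, then the
distance to `K` grows from `x` in the direction `x - P x` with a slope arbitrarily close to one. -/
theorem exists_pos_infDist_add_le_infDist_add_smul {X : Type*} [NormedAddCommGroup X]
    [NormedSpace ℝ X] {K : Set X} {P : X → X} (hPK : ∀ x, P x ∈ K)
    (hPd : ∀ x, ‖x - P x‖ = infDist x K) {x : X} (hx : 0 < infDist x K)
    (hP : Tendsto P (𝓝 x) (𝓝 (P x))) {α : ℝ} (hα : α < 1) {r : ℝ} (hr : 0 < r) :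
    ∃ t, 0 < t ∧ t < r ∧
      infDist x K + α * (t * infDist x K) ≤ infDist (x + t • (x - P x)) K := by
  have hcont : Tendsto (fun t : ℝ => x + t • (x - P x)) (𝓝[>] 0) (𝓝 x) := by
    have : Continuous fun t : ℝ => x + t • (x - P x) := by fun_prop
    simpa using (this.tendsto 0).mono_left nhdsWithin_le_nhds
  have hev := (hP.comp hcont).eventually
    (Metric.ball_mem_nhds (P x) (show 0 < (1 - α) * infDist x K from
      mul_pos (by linarith) hx))
  obtain ⟨t, ht, ht0, htr⟩ := (hev.and (Ioo_mem_nhdsGT hr)).exists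
  refine ⟨t, ht0, htr, ?_⟩
  set y := x + t • (x - P x) with hy
  have hdist : ‖P y - P x‖ < (1 - α) * infDist x K := by simpa [dist_eq_norm] using ht
  have hxy : infDist x K ≤ ‖x - P y‖ := by
    rw [← dist_eq_norm]
    exact infDist_le_dist_of_mem (hPK y)
  -- Norming `x - P y` instead of `x - P x` bounds the distance at `y` from below; the discrepancy
  -- is at most `‖P y - P x‖`, small by continuity.
  obtain ⟨f, hf1, hf⟩ := exists_dual_vector'' ℝ (x - P y)
  have hfle : ∀ z, f z ≤ ‖z‖ := fun z =>
    (le_abs_self _).trans ((f.le_opNorm _).trans (mul_le_of_le_one_left (norm_nonneg _) hf1))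
  have hf' : f (x - P y) = ‖x - P y‖ := hf
  have h1 : f (y - P y) = f (x - P y) + t * (f (x - P y) + f (P y - P x)) := by
    simp only [hy, map_add, map_sub, map_smul, smul_eq_mul]
    ring
  have h2 : -f (P y - P x) ≤ ‖P y - P x‖ := by
    rw [← map_neg, ← norm_neg (P y - P x)]
    exact hfle _
  have h3 : α * infDist x K ≤ f (x - P y) + f (P y - P x) := by linarith
  have h4 := mul_le_mul_of_nonneg_left h3 ht0.le
  have h5 := hfle (y - P y)
  rw [hPd y] at h5
  linarith

/-- In a uniformly convex space, if the metric projection `P` onto `K` is continuous, then the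
distance to `K` doubles when a point `x` is reflected in the direction opposite to `P x`. -/
theorem infDist_add_sub_eq_two_mul {X : Type*} [NormedAddCommGroup X]
    [NormedSpace ℝ X] [CompleteSpace X] [UniformConvexSpace X] {K : Set X} {P : X → X}
    (hPK : ∀ x, P x ∈ K) (hPd : ∀ x, ‖x - P x‖ = infDist x K) (hP : Continuous P) {x : X}
    (hx : 0 < infDist x K) : infDist (x + (x - P x)) K = 2 * infDist x K := by
  set r := infDist x K with hr
  have hup : infDist (x + (x - P x)) K ≤ 2 * r := by
    calc infDist (x + (x - P x)) K ≤ dist (x + (x - P x)) (P x) := infDist_le_dist_of_mem (hPK x)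
      _ = ‖(x - P x) + (x - P x)‖ := by rw [dist_eq_norm]; congr 1; abel
      _ ≤ ‖x - P x‖ + ‖x - P x‖ := norm_add_le _ _
      _ = 2 * r := by rw [hPd]; ring
  refine le_antisymm hup (le_of_forall_pos_le_add fun ε hε => ?_)
  obtain ⟨δ, hδ, h⟩ := exists_forall_norm_le_add_norm_sub_lt (E := X) (half_pos hε) hx.le
  -- Slope `1 - β` will give distance at least `(2 - β) * r` at `y`. The loss `β * r` must fit both
  -- the modulus `δ` and half of the final error.
  obtain ⟨β, hβ0, hβ1, hβδ, hβε⟩ :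
      ∃ β, 0 < β ∧ β < 1 ∧ β * r ≤ δ ∧ β * r ≤ ε / 2 := by
    refine ⟨min (1 / 2) (min (δ / r) (ε / 2 / r)), by positivity,
      (min_le_left _ _).trans_lt (by norm_num), ?_, ?_⟩
    · rw [← le_div_iff₀ hx]
      exact (min_le_right _ _).trans (min_le_left _ _)
    · rw [← le_div_iff₀ hx]
      exact (min_le_right _ _).trans (min_le_right _ _)
  have : CompleteSpace (closedBall x r) := isClosed_closedBall.completeSpace_coe
  obtain ⟨⟨y, hyB⟩, hxy, hmax⟩ := exists_forall_add_mul_dist_le_imp_eq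
    (α := closedBall x r) (g := fun z => infDist (z : X) K)
    ((continuous_infDist_pt K).comp continuous_subtype_val)
    ⟨r + r, by
      rintro _ ⟨⟨z, hz⟩, rfl⟩
      exact (infDist_le_infDist_add_dist (s := K) (x := z) (y := x)).trans
        (by gcongr; exact hz)⟩
    (show 0 < 1 - β by linarith) ⟨x, mem_closedBall_self hx.le⟩
  simp only [Subtype.dist_eq] at hxy hmax
  have hyd : 0 < infDist y K := by
    have : 0 ≤ (1 - β) * dist x y := mul_nonneg (by linarith) dist_nonneg
    linarith
  -- At an interior point, a short step along `y - P y` would stay in the ball and contradict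
  -- Ekeland maximality.
  have hyr : dist y x = r := by
    refine le_antisymm hyB (not_lt.1 fun hlt => ?_)
    obtain ⟨t, ht0, htr, hty⟩ := exists_pos_infDist_add_le_infDist_add_smul hPK hPd hyd
      (hP.tendsto y) (show 1 - β < 1 by linarith) (div_pos (sub_pos.2 hlt) hyd)
    rw [lt_div_iff₀ hyd] at htr
    set z := y + t • (y - P y) with hz
    have hyz : dist y z = t * infDist y K := by
      rw [hz, dist_self_add_right, norm_smul_of_nonneg ht0.le, hPd]
    have hzB : z ∈ closedBall x r := by
      rw [mem_closedBall]
      have := dist_triangle z y x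
      rw [dist_comm z y] at this
      linarith
    have heq := hmax ⟨z, hzB⟩ (by simpa only [hyz] using hty)
    have heq' : z = y := congrArg Subtype.val heq
    rw [heq', dist_self] at hyz
    exact (mul_pos ht0 hyd).ne hyz
  rw [dist_comm, hyr] at hxy
  have hnorm : infDist y K ≤ ‖(x - P x) + (y - x)‖ := by
    rw [show (x - P x) + (y - x) = y - P x by abel, ← dist_eq_norm]
    exact infDist_le_dist_of_mem (hPK x)
  have hclose := h (x - P x) (y - x) (by rw [hPd]; linarith)
    (by rw [← dist_eq_norm, hyr]; linarith) (by linarith)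
  have hlip := infDist_le_infDist_add_dist (s := K) (x := y) (y := x + (x - P x))
  rw [dist_comm, dist_eq_norm, show x + (x - P x) - y = (x - P x) - (y - x) by abel] at hlip
  linarith

/-! ### Supporting half-spaces and convexity -/

/-- If `h` does not decrease the norm of `u` along the ray from `u` in the direction `h`, then some
support functional of `u` is nonnegative at `h`. -/
theorem exists_isSupportFunctional_nonneg {X : Type*} [NormedAddCommGroup X] [NormedSpace ℝ X]
    {u h : X} (hu : u ≠ 0) (hray : ∀ t : ℝ, 0 ≤ t → ‖u‖ ≤ ‖u + t • h‖) :
    ∃ f : StrongDual ℝ X, IsSupportFunctional f u ∧ 0 ≤ f h := by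
  have hu0 : 0 < ‖u‖ := norm_pos_iff.2 hu
  have hconv : Convex ℝ ((fun t : ℝ => u + t • h) '' Ici 0) := by
    rintro _ ⟨s, hs, rfl⟩ _ ⟨t, ht, rfl⟩ a b ha hb hab
    refine ⟨a * s + b * t, add_nonneg (mul_nonneg ha hs) (mul_nonneg hb ht), ?_⟩
    have : u = a • u + b • u := by rw [← add_smul, hab, one_smul]
    simp only [smul_add, add_smul, mul_smul]
    nth_rw 1 [this]
    abel
  obtain ⟨g, c, hgb, hgr⟩ := geometric_hahn_banach_open (convex_ball (0 : X) ‖u‖) isOpen_ball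
    hconv (by
      rw [Set.disjoint_right]
      rintro _ ⟨t, ht, rfl⟩ hmem
      rw [mem_ball_zero_iff] at hmem
      exact hmem.not_ge (hray t ht))
  have hgray : ∀ t : ℝ, 0 ≤ t → c ≤ g u + t * g h := fun t ht => by
    simpa using hgr _ ⟨t, ht, rfl⟩
  have hgu : c ≤ g u := by simpa using hgray 0 le_rfl
  have hgball : ∀ z ∈ closedBall (0 : X) ‖u‖, g z ≤ c := by
    rw [← closure_ball 0 hu0.ne']
    exact fun z hz => closure_minimal (fun z hz => (hgb z hz).le)
      (isClosed_le g.continuous continuous_const) hz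
  -- `u` lies both in the closed ball and on the ray, so `g` attains its maximum over the ball at
  -- `u`.
  have hc : c = g u := le_antisymm hgu (hgball u (by simp))
  have hgu0 : 0 < g u := by
    have := hgb 0 (mem_ball_self hu0)
    rwa [map_zero, hc] at this
  have hgnorm : ‖g‖ = g u / ‖u‖ := by
    refine le_antisymm (g.opNorm_le_bound (by positivity) fun z => ?_) ?_
    · by_cases hz : z = 0
      · simp [hz]
      have hz0 : 0 < ‖z‖ := norm_pos_iff.2 hz
      have key : ∀ v : X, ‖v‖ = ‖z‖ → g v ≤ g u / ‖u‖ * ‖z‖ := by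
        intro v hv
        have := hgball ((‖u‖ / ‖z‖) • v) (by
          rw [mem_closedBall_zero_iff, norm_smul_of_nonneg (by positivity), hv,
            div_mul_cancel₀ _ hz0.ne'])
        rw [map_smul, smul_eq_mul, hc] at this
        rw [div_mul_eq_mul_div, le_div_iff₀ hu0]
        rw [div_mul_eq_mul_div, div_le_iff₀ hz0] at this
        linarith
      refine abs_le'.2 ⟨key z rfl, ?_⟩
      rw [← map_neg]
      exact key (-z) (norm_neg z)
    · rw [div_le_iff₀ hu0]
      exact (le_abs_self _).trans (g.le_opNorm u)
  have hg0 : 0 < ‖g‖ := hgnorm ▸ div_pos hgu0 hu0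
  refine ⟨‖g‖⁻¹ • g, ⟨?_, ?_⟩, ?_⟩
  · rw [norm_smul, norm_inv, norm_norm, inv_mul_cancel₀ hg0.ne']
  · rw [smul_apply, smul_eq_mul, hgnorm]
    field_simp
  · have := hgray 1 zero_le_one
    rw [smul_apply, smul_eq_mul]
    exact mul_nonneg (by positivity) (by linarith)

theorem theorem3p5 {X : Type*} [NormedAddCommGroup X] [NormedSpace ℝ X] [CompleteSpace X]
    [UniformConvexSpace X] (hX : IsSmoothNormedSpace X) (K : Set X)
    (hK : IsChebyshevSet K) (hKw : IsWeaklyClosed K) :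
    Convex ℝ K := by
  choose P hP huniq using hK.2
  have hPK : ∀ x, P x ∈ K := fun x => (hP x).1
  have hPd : ∀ x, ‖x - P x‖ = infDist x K := fun x => (hP x).2
  have hPc : Continuous P := by
    refine continuous_iff_continuousAt.2 fun x => hKw.tendsto_bestApproximation
      (fun v hv hvd => huniq x v ⟨hv, hvd⟩) (Eventually.of_forall hPK) ?_
    have hlim : Tendsto (fun y => dist y x + infDist y K) (𝓝 x) (𝓝 (infDist x K)) := by
      have : Continuous fun y => dist y x + infDist y K := by fun_prop
      simpa using this.tendsto x
    refine tendsto_of_tendsto_of_tendsto_of_le_of_le tendsto_const_nhds hlim (fun y => ?_)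
      (fun y => ?_)
    · rw [← dist_eq_norm]
      exact infDist_le_dist_of_mem (hPK y)
    · have := dist_triangle x y (P y)
      rwa [dist_comm x y, dist_eq_norm, dist_eq_norm y (P y), hPd] at this
  have hsun : ∀ x, x ∉ K → ∀ n : ℕ,
      P (P x + (2 : ℝ) ^ n • (x - P x)) = P x ∧
        infDist (P x + (2 : ℝ) ^ n • (x - P x)) K = 2 ^ n * ‖x - P x‖ := by
    intro x hx n
    have hne : 0 < ‖x - P x‖ := norm_sub_pos_iff.2 fun h => hx (h ▸ hPK x)
    induction n with
    | zero => simp [hPd]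
    | succ n ih =>
      set y := P x + (2 : ℝ) ^ n • (x - P x) with hy
      have hstep := infDist_add_sub_eq_two_mul hPK hPd hPc (x := y)
        (by rw [ih.2]; positivity)
      have heq : y + (y - P y) = P x + (2 : ℝ) ^ (n + 1) • (x - P x) := by
        rw [ih.1, hy, pow_succ, mul_two, add_smul]
        abel
      rw [heq, ih.2] at hstep
      have hd : infDist (P x + (2 : ℝ) ^ (n + 1) • (x - P x)) K = 2 ^ (n + 1) * ‖x - P x‖ := by
        rw [hstep]
        ring
      refine ⟨(huniq _ (P x) ⟨hPK x, ?_⟩).symm, hd⟩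
      rw [hd, add_sub_cancel_left, norm_smul_of_nonneg (by positivity)]
  have hsep : ∀ x, x ∉ K → ∃ f : StrongDual ℝ X, f (P x) < f x ∧ ∀ w ∈ K, f w ≤ f (P x) := by
    intro x hx
    have hne : x - P x ≠ 0 := sub_ne_zero.2 fun h => hx (h ▸ hPK x)
    obtain ⟨f, hf, hfu⟩ := hX _ hne
    refine ⟨f, ?_, fun w hw => ?_⟩
    · have := hf.2
      rw [map_sub] at this
      linarith [norm_pos_iff.2 hne]
    -- Once `2 ^ n > t⁻¹`, the sun property at `w` and the triangle inequality give the ray bound: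
    -- the excess `(2 ^ n - t⁻¹) * ‖u‖` cancels.
    obtain ⟨g, hg, hgw⟩ := exists_isSupportFunctional_nonneg (h := P x - w) hne (by
      intro t ht
      set u := x - P x
      obtain rfl | ht0 := ht.eq_or_lt
      · simp
      obtain ⟨n, hn⟩ := pow_unbounded_of_one_lt t⁻¹ (one_lt_two : (1 : ℝ) < 2)
      have h1 : 2 ^ n * ‖u‖ ≤ ‖P x + (2 : ℝ) ^ n • u - w‖ := by
        rw [← (hsun x hx n).2, ← dist_eq_norm]
        exact infDist_le_dist_of_mem hw
      have h2 : P x + (2 : ℝ) ^ n • u - w = t⁻¹ • (u + t • (P x - w)) + ((2 : ℝ) ^ n - t⁻¹) • u := by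
        rw [smul_add, smul_smul, inv_mul_cancel₀ ht0.ne', one_smul, sub_smul]
        abel
      have h3 := norm_add_le (t⁻¹ • (u + t • (P x - w))) (((2 : ℝ) ^ n - t⁻¹) • u)
      rw [← h2, norm_smul_of_nonneg (inv_nonneg.2 ht),
        norm_smul_of_nonneg (sub_nonneg.2 hn.le)] at h3
      exact le_of_mul_le_mul_left (by linarith) (inv_pos.2 ht0))
    -- The functional `g` depends on `w`; smoothness identifies it with the fixed `f`.
    rw [hfu g hg, map_sub] at hgw
    linarith
  intro a ha b hb s t hs ht hst
  by_contra hmem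
  obtain ⟨f, hlt, hle⟩ := hsep _ hmem
  have hcomb : f (s • a + t • b) ≤ f (P (s • a + t • b)) := by
    rw [map_add, map_smul, map_smul, smul_eq_mul, smul_eq_mul]
    calc s * f a + t * f b
        ≤ s * f (P (s • a + t • b)) + t * f (P (s • a + t • b)) := by
          gcongr
          exacts [hle a ha, hle b hb]
      _ = f (P (s • a + t • b)) := by rw [← add_mul, hst, one_mul]
  exact hlt.not_ge hcomb
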